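/- Let $m\ge 0$, let $G'=F(x_1,\dots,x_m)$ and $G=F(y_1,\dots,y_m)$ be free groups of rank $m$, and let $\lambda'\in G'$ and $\lambda\in G$. Let $\epsilon\colon G'\to G$ be a group isomorphism and let $\tau\colon\mathbb C[G']\to\mathbb C[G]$ be the isomorphism of group algebras induced by $\epsilon$. Write $(\lambda'-1)\subset\mathbb C[G']$ and $(\lambda-1)\subset\mathbb C[G]$ for the two-sided ideals generated by $\lambda'-1$ and $\lambda-1$, and let $p\colon\mathbb C[G']\to\mathbb C[G']/(\lambda'-1)$ and $q\colon\mathbb C[G]\to\mathbb C[G]/(\lambda-1)$ be the quotient maps. Suppose there is an isomorphism of $\mathbb C$-algebras $\widetilde\tau\colon\mathbb C[G']/(\lambda'-1)\to\mathbb C[G]/(\lambda-1)$ with $\widetilde\tau\circ p=q\circ\tau$. Then there exist a group element $u\in G$ (a monomial in $y_1^{\pm1},\dots,y_m^{\pm1}$) and $c\in\{1,-1\}$ such that $$\tau(\lambda')=u\,\lambda^{c}\,u^{-1}\quad\text{in }\mathbb C[G].$$ -/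

import Mathlib

/-- The two-sided ideal `(w - 1)` of the complex group algebra `ℂ[G]` generated by `w - 1`,
for an element `w` of the group `G`. -/
noncomputable def wordIdeal {G : Type*} [Group G] (w : G) : TwoSidedIdeal (MonoidAlgebra ℂ G) :=
  TwoSidedIdeal.span {MonoidAlgebra.of ℂ G w - 1}

/-- The quotient algebra `ℂ[G] / (w - 1)`. -/
abbrev WordQuotient {G : Type*} [Group G] (w : G) : Type _ :=
  (wordIdeal w).ringCon.Quotient

/-- The quotient map `ℂ[G] → ℂ[G] / (w - 1)`. -/
noncomputable def wordQuotientMap {G : Type*} [Group G] (w : G) :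
    MonoidAlgebra ℂ G →ₐ[ℂ] WordQuotient w :=
  (wordIdeal w).ringCon.mkₐ ℂ

/-!
The quotient `ℂ[G] / (λ - 1)` is the group algebra of `G / ⟪λ⟫`, where `⟪λ⟫` is the normal closure
of `λ`; hence a group element `g` becomes `1` in it exactly if `g ∈ ⟪λ⟫`
(`OneRelator.wordQuotientMap_of_eq_one_iff`). The isomorphism of the quotients compatible with `τ`
therefore yields `⟪ε λ'⟫ = ⟪λ⟫`, and the claim is Magnus's conjugacy theorem
(`OneRelator.isConj_or_isConj_inv_of_normalClosure_singleton_eq`): in a free group, elements with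
the same normal closure are conjugate up to inversion.

Magnus's theorem rests on his Freiheitssatz (`OneRelator.isFreiheit_of_isCyclicallyReduced`), and
both are proved by induction on the length of a cyclically reduced relator `L`. If `L` involves
only one generator, a retraction, respectively divisibility of exponents, suffices. Otherwise
there is an integer weight `w` on the generators that is zero on `L` and nonzero on some generator
`t` of `L`. Reading the partial weights as levels, `L` is rewritten as a shorter word `R` in the
letters `(x, i)`, with `x ≠ t` a generator and `i` a level (`OneRelator.rewrite`). Choose a second
generator `y` of `L`, and keep of the letters `(y, i)` only those between the lowest and the
highest that occur in `R`. By the Freiheitssatz for `R`, dropping the highest or the lowest of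
these gives subgroups of the one-relator group of `R` that are free on the remaining letters.
Raising the level by one is thus an isomorphism between them, and the one-relator group of `R`
embeds in the corresponding HNN extension. The group of `L` maps to that extension, with `t` going
to a power of the stable letter, so that consequences of `L` become consequences of `R`
(`OneRelator.mem_normalClosure_of_rewrite`).

For the Freiheitssatz it remains to see that a consequence of `L` avoiding a generator of `L` is
rewritten as a word avoiding some letter of `R`. For the conjugacy theorem, the Freiheitssatz
shows that two relators with the same normal closure occupy intervals of levels of the same length
(`OneRelator.window_le`); their rewritings then have the same normal closure, and are conjugate up
to inversion by induction. Conjugate cyclically reduced words are cyclic permutations of each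
other, and cyclic permutations lift through the rewriting
(`OneRelator.isConj_of_isRotated_rewrite`). Working with words here makes up for the fact that the
substitution of a power of the stable letter for `t` is not onto.
-/

namespace OneRelator

open FreeGroup

universe u

variable {α : Type u}

/-! ### Weights and the rewriting of words -/

/-- The value on the word `L` of the homomorphism from the free group to `ℤ` sending each
generator `x` to `w x`. For `w = Pi.single y 1` it is the exponent sum of `y` in `L`. -/
def weight (w : α → ℤ) (L : List (α × Bool)) : ℤ :=
  (L.map fun p => cond p.2 (w p.1) (-w p.1)).sum

@[simp] lemma weight_nil (w : α → ℤ) : weight w [] = 0 := rfl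

@[simp] lemma weight_cons (w : α → ℤ) (p : α × Bool) (L : List (α × Bool)) :
    weight w (p :: L) = cond p.2 (w p.1) (-w p.1) + weight w L := by
  simp [weight]

@[simp] lemma weight_append (w : α → ℤ) (L₁ L₂ : List (α × Bool)) :
    weight w (L₁ ++ L₂) = weight w L₁ + weight w L₂ := by
  simp [weight]

lemma weight_linear (a b : ℤ) (w₁ w₂ : α → ℤ) (L : List (α × Bool)) :
    weight (fun x => a * w₁ x + b * w₂ x) L = a * weight w₁ L + b * weight w₂ L := by
  induction L with
  | nil => simp
  | cons p L ih =>
    rcases p with ⟨x, _ | _⟩ <;> simp [ih] <;> ring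

lemma weight_invRev (w : α → ℤ) (L : List (α × Bool)) :
    weight w (invRev L) = -weight w L := by
  induction L with
  | nil => simp
  | cons p L ih =>
    rw [invRev_cons, weight_append, ih]
    rcases p with ⟨x, _ | _⟩ <;> simp [invRev]

lemma lift_ofAdd_mk (w : α → ℤ) (L : List (α × Bool)) :
    FreeGroup.lift (fun x => Multiplicative.ofAdd (w x)) (mk L)
      = Multiplicative.ofAdd (weight w L) := by
  rw [lift_mk]
  induction L with
  | nil => simp
  | cons p L ih =>
    rcases p with ⟨x, _ | _⟩ <;> simp [ih, ofAdd_add]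

lemma dvd_weight_of_mem_normalClosure {w : α → ℤ} {L W : List (α × Bool)}
    (h : mk W ∈ Subgroup.normalClosure {mk L}) : weight w L ∣ weight w W := by
  let f := FreeGroup.lift (fun x => Multiplicative.ofAdd (w x))
  have key : Subgroup.normalClosure {mk L} ≤
      (Subgroup.zpowers (Multiplicative.ofAdd (weight w L))).comap f := by
    apply Subgroup.normalClosure_le_normal
    rintro _ rfl
    exact ⟨1, by simpa only [zpow_one] using (lift_ofAdd_mk w L).symm⟩
  obtain ⟨k, hk⟩ := key h
  rw [lift_ofAdd_mk] at hk
  refine ⟨k, ?_⟩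
  have := congrArg Multiplicative.toAdd hk
  simp only [toAdd_zpow, toAdd_ofAdd] at this
  rw [← this, smul_eq_mul, mul_comm]

open Classical in
/-- Magnus's rewriting of a word along the integer weight `w`, with `t` as stable letter. While
reading the word from the left, keep track of the level, which starts at `c` and changes by `± w x`
at each letter `x ^ ± 1`. Letters `t ^ ± 1` are deleted; any other letter is recorded together with
a level: the one before it if its exponent is `1`, the one after it if its exponent is `-1`. (With
this choice the rewriting of an inverse is the inverse of a rewriting.) -/
noncomputable def rewrite (t : α) (w : α → ℤ) : ℤ → List (α × Bool) → List ((α × ℤ) × Bool)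
  | _, [] => []
  | c, (x, b) :: L =>
    if x = t then rewrite t w (c + cond b (w x) (-w x)) L
    else ((x, cond b c (c - w x)), b) :: rewrite t w (c + cond b (w x) (-w x)) L

variable {t : α} {w : α → ℤ} {c : ℤ}

@[simp] lemma rewrite_nil : rewrite t w c [] = [] := rfl

lemma rewrite_cons_self (b : Bool) (L : List (α × Bool)) :
    rewrite t w c ((t, b) :: L) = rewrite t w (c + cond b (w t) (-w t)) L := by
  simp [rewrite]

lemma rewrite_cons_of_ne {x : α} (hx : x ≠ t) (b : Bool) (L : List (α × Bool)) :
    rewrite t w c ((x, b) :: L) =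
      ((x, cond b c (c - w x)), b) :: rewrite t w (c + cond b (w x) (-w x)) L := by
  simp [rewrite, hx]

lemma rewrite_append (L₁ L₂ : List (α × Bool)) :
    rewrite t w c (L₁ ++ L₂) = rewrite t w c L₁ ++ rewrite t w (c + weight w L₁) L₂ := by
  induction L₁ generalizing c with
  | nil => simp
  | cons p L ih =>
    obtain ⟨x, b⟩ := p
    by_cases hx : x = t
    · subst hx
      simp [rewrite_cons_self, ih, add_assoc]
    · simp [rewrite_cons_of_ne hx, ih, add_assoc]

lemma rewrite_add (d : ℤ) (L : List (α × Bool)) :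
    rewrite t w (c + d) L = (rewrite t w c L).map fun p => ((p.1.1, p.1.2 + d), p.2) := by
  induction L generalizing c with
  | nil => simp
  | cons p L ih =>
    obtain ⟨x, b⟩ := p
    by_cases hx : x = t
    · subst hx
      simp [rewrite_cons_self, ← ih, add_right_comm]
    · rw [rewrite_cons_of_ne hx, rewrite_cons_of_ne hx, List.map_cons, ← ih, add_right_comm]
      cases b <;> simp [sub_add_eq_add_sub]

lemma rewrite_invRev (L : List (α × Bool)) :
    rewrite t w c (invRev L) = invRev (rewrite t w (c - weight w L) L) := by
  induction L generalizing c with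
  | nil => simp
  | cons p L ih =>
    obtain ⟨x, b⟩ := p
    rw [invRev_cons, rewrite_append, ih, weight_invRev]
    by_cases hx : x = t
    · subst hx
      have h : c - weight w ((x, b) :: L) + cond b (w x) (-w x) = c - weight w L := by
        rw [weight_cons]; ring
      rw [rewrite_cons_self, h]
      simp [invRev, rewrite_cons_self]
    · rw [rewrite_cons_of_ne hx, invRev_cons (L := rewrite _ _ _ _)]
      congr 1
      · congr 2
        cases b <;> simp <;> ring
      · cases b <;> simp [invRev, rewrite_cons_of_ne hx] <;> ring

lemma ne_of_mem_rewrite {L : List (α × Bool)} {p : (α × ℤ) × Bool}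
    (hp : p ∈ rewrite t w c L) : p.1.1 ≠ t := by
  induction L generalizing c with
  | nil => simp at hp
  | cons q L ih =>
    obtain ⟨x, b⟩ := q
    by_cases hx : x = t
    · subst hx
      rw [rewrite_cons_self] at hp
      exact ih hp
    · rw [rewrite_cons_of_ne hx, List.mem_cons] at hp
      rcases hp with rfl | hp
      · exact hx
      · exact ih hp

lemma mem_of_mem_rewrite {L : List (α × Bool)} {p : (α × ℤ) × Bool}
    (hp : p ∈ rewrite t w c L) : (p.1.1, p.2) ∈ L := by
  induction L generalizing c with
  | nil => simp at hp
  | cons q L ih =>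
    obtain ⟨x, b⟩ := q
    by_cases hx : x = t
    · subst hx
      rw [rewrite_cons_self] at hp
      exact List.mem_cons_of_mem _ (ih hp)
    · rw [rewrite_cons_of_ne hx, List.mem_cons] at hp
      rcases hp with rfl | hp
      · simp
      · exact List.mem_cons_of_mem _ (ih hp)

lemma exists_mem_rewrite {L : List (α × Bool)} {p : α × Bool} (hp : p ∈ L) (hpt : p.1 ≠ t) :
    ∃ i, ((p.1, i), p.2) ∈ rewrite t w c L := by
  induction L generalizing c with
  | nil => simp at hp
  | cons q L ih =>
    obtain ⟨x, b⟩ := q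
    by_cases hx : x = t
    · subst hx
      rw [rewrite_cons_self]
      rcases List.mem_cons.1 hp with rfl | hp
      · exact absurd rfl hpt
      · exact ih hp
    · rw [rewrite_cons_of_ne hx]
      rcases List.mem_cons.1 hp with rfl | hp
      · exact ⟨_, List.mem_cons_self⟩
      · obtain ⟨i, hi⟩ := ih (c := c + cond b (w x) (-w x)) hp
        exact ⟨i, List.mem_cons_of_mem _ hi⟩

lemma length_rewrite_le (L : List (α × Bool)) : (rewrite t w c L).length ≤ L.length := by
  induction L generalizing c with
  | nil => simp
  | cons q L ih =>
    obtain ⟨x, b⟩ := q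
    by_cases hx : x = t
    · subst hx
      rw [rewrite_cons_self]
      exact ih.trans (by simp)
    · rw [rewrite_cons_of_ne hx]
      simpa using ih

lemma length_rewrite_lt {L : List (α × Bool)} {b : Bool} (hb : (t, b) ∈ L) :
    (rewrite t w c L).length < L.length := by
  obtain ⟨L₁, L₂, rfl⟩ := List.append_of_mem hb
  rw [rewrite_append, rewrite_cons_self]
  have h₁ := length_rewrite_le (t := t) (w := w) (c := c) L₁
  have h₂ := length_rewrite_le (t := t) (w := w)
    (c := c + weight w L₁ + cond b (w t) (-w t)) L₂
  simp only [List.length_append, List.length_cons]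
  omega

/-- The first letter of the rewriting of a reduced word that starts with a power of `t`
records a level different from the initial one. -/
lemma level_head_rewrite_cons_self (ht : w t ≠ 0) {b : Bool} {L : List (α × Bool)}
    (hL : IsReduced ((t, b) :: L)) {p : (α × ℤ) × Bool}
    (hp : p ∈ (rewrite t w c ((t, b) :: L)).head?) :
    p.1.2 + cond p.2 0 (w p.1.1) ≠ c := by
  -- A reduced word starting with `t ^ ± 1` starts with `k + 1` copies of that letter.
  have key : ∀ (L : List (α × Bool)) (c : ℤ), IsReduced ((t, b) :: L) →
      p ∈ (rewrite t w c ((t, b) :: L)).head? → ∃ k : ℕ,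
      p.1.2 + cond p.2 0 (w p.1.1) = c + (k + 1) * cond b (w t) (-w t) := by
    intro L
    induction L with
    | nil => intro c _ h; simp [rewrite_cons_self] at h
    | cons q L ih =>
      intro c hr h
      obtain ⟨x, b'⟩ := q
      rw [rewrite_cons_self] at h
      rw [isReduced_cons_cons] at hr
      by_cases hx : x = t
      · subst hx
        obtain rfl : b = b' := hr.1 rfl
        obtain ⟨k, hk⟩ := ih _ hr.2 h
        exact ⟨k + 1, by rw [hk]; push_cast; ring⟩
      · rw [rewrite_cons_of_ne hx] at h
        simp only [List.head?_cons, Option.mem_def, Option.some.injEq] at h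
        subst h
        refine ⟨0, ?_⟩
        cases b' <;> simp
  obtain ⟨k, hk⟩ := key L c hL hp
  rw [hk]
  have h1 : (k + 1 : ℤ) ≠ 0 := by positivity
  have h2 : cond b (w t) (-w t) ≠ 0 := by cases b <;> simpa
  simpa using ⟨h1, h2⟩

lemma isReduced_cons_iff {β : Type*} {p : β × Bool} {L : List (β × Bool)} :
    IsReduced (p :: L) ↔ (∀ q ∈ L.head?, p.1 = q.1 → p.2 = q.2) ∧ IsReduced L := by
  simp only [FreeGroup.IsReduced, List.isChain_cons]

/-- Two neighbouring letters of the rewriting are either neighbours in the word or separated by a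
nonzero power of `t`, which forces different levels because `w t ≠ 0`. -/
lemma isReduced_rewrite (ht : w t ≠ 0) {L : List (α × Bool)} (hL : IsReduced L) :
    IsReduced (rewrite t w c L) := by
  induction L generalizing c with
  | nil => simp
  | cons p L ih =>
    obtain ⟨x, b⟩ := p
    have hL' := (isReduced_cons_iff.1 hL).2
    by_cases hx : x = t
    · subst hx
      rw [rewrite_cons_self]
      exact ih hL'
    · rw [rewrite_cons_of_ne hx, isReduced_cons_iff]
      refine ⟨?_, ih hL'⟩
      rintro ⟨⟨x', i⟩, b'⟩ hq he
      simp only [Prod.mk.injEq] at he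
      obtain ⟨rfl, hi⟩ := he
      rcases L with _ | ⟨⟨x'', b''⟩, L⟩
      · simp at hq
      by_cases hx'' : x'' = t
      · subst hx''
        have := level_head_rewrite_cons_self ht hL' hq
        revert this hi
        cases b <;> cases b' <;> simp <;> omega
      · rw [rewrite_cons_of_ne hx''] at hq
        simp only [List.head?_cons, Option.mem_def, Option.some.injEq, Prod.mk.injEq] at hq
        obtain ⟨⟨rfl, -⟩, rfl⟩ := hq
        exact (isReduced_cons_cons.1 hL).1 rfl

lemma isCyclicallyReduced_iff_append_self {β : Type*} {L : List (β × Bool)} :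
    IsCyclicallyReduced L ↔ IsReduced (L ++ L) := by
  rw [isCyclicallyReduced_iff]
  simp only [FreeGroup.IsReduced, List.isChain_append]
  tauto

lemma isCyclicallyReduced_rewrite (ht : w t ≠ 0) {L : List (α × Bool)}
    (hL : IsCyclicallyReduced L) (h0 : weight w L = 0) :
    IsCyclicallyReduced (rewrite t w c L) := by
  rw [isCyclicallyReduced_iff_append_self] at hL ⊢
  have := isReduced_rewrite (c := c) ht hL
  rwa [rewrite_append, h0, add_zero] at this

lemma eq_nil_of_rewrite_eq_nil (ht : w t ≠ 0) {L : List (α × Bool)} (hL : IsReduced L)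
    (h0 : weight w L = 0) (h : rewrite t w c L = []) : L = [] := by
  rcases L with _ | ⟨⟨x, b⟩, L⟩
  · rfl
  exfalso
  have key : ∀ (L : List (α × Bool)) (c : ℤ), IsReduced ((x, b) :: L) →
      rewrite t w c ((x, b) :: L) = [] → ∃ k : ℕ,
      weight w ((x, b) :: L) = (k + 1) * cond b (w t) (-w t) := by
    intro L
    induction L with
    | nil =>
      intro c _ h
      by_cases hx : x = t
      · subst hx; exact ⟨0, by simp⟩
      · simp [rewrite_cons_of_ne hx] at h
    | cons q L ih =>
      intro c hr h
      obtain ⟨x', b'⟩ := q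
      by_cases hx : x = t
      · subst hx
        rw [rewrite_cons_self] at h
        rw [isReduced_cons_cons] at hr
        by_cases hx' : x' = x
        · subst hx'
          obtain rfl : b = b' := hr.1 rfl
          obtain ⟨k, hk⟩ := ih _ hr.2 h
          exact ⟨k + 1, by rw [weight_cons, hk]; push_cast; ring⟩
        · simp [rewrite_cons_of_ne hx'] at h
      · simp [rewrite_cons_of_ne hx] at h
  obtain ⟨k, hk⟩ := key L c hL h
  rw [h0] at hk
  have h1 : (k + 1 : ℤ) ≠ 0 := by positivity
  have h2 : cond b (w t) (-w t) ≠ 0 := by cases b <;> simpa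
  exact mul_ne_zero h1 h2 hk.symm

/-- The initial level can be chosen such that the levels of `y` fill an interval starting at `0`. -/
lemma exists_normalized_level (w : α → ℤ) {t y : α} (hyt : y ≠ t) {L : List (α × Bool)} {b : Bool}
    (hy : (y, b) ∈ L) :
    ∃ c M : ℤ, (∀ i b, ((y, i), b) ∈ rewrite t w c L → 0 ≤ i ∧ i ≤ M) ∧
      (∃ b, ((y, 0), b) ∈ rewrite t w c L) ∧ (∃ b, ((y, M), b) ∈ rewrite t w c L) := by
  classical
  let s : Finset ℤ := (((rewrite t w 0 L).filter fun p => p.1.1 = y).map fun p => p.1.2).toFinset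
  have hs : ∀ i, i ∈ s ↔ ∃ b, ((y, i), b) ∈ rewrite t w 0 L := by
    intro i
    simp [s]
  have hne : s.Nonempty := by
    obtain ⟨i, hi⟩ := exists_mem_rewrite (w := w) (c := 0) hy hyt
    exact ⟨i, (hs i).2 ⟨_, hi⟩⟩
  have hshift : ∀ i b d, ((y, i), b) ∈ rewrite t w d L ↔ ((y, i - d), b) ∈ rewrite t w 0 L := by
    intro i b d
    have := rewrite_add (t := t) (w := w) (c := 0) d L
    rw [zero_add] at this
    rw [this, List.mem_map]
    constructor
    · rintro ⟨⟨⟨x, j⟩, b'⟩, h, he⟩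
      simp only [Prod.mk.injEq] at he
      obtain ⟨⟨rfl, rfl⟩, rfl⟩ := he
      simpa using h
    · intro h
      exact ⟨_, h, by simp⟩
  refine ⟨-s.min' hne, s.max' hne - s.min' hne, ?_, ?_, ?_⟩
  · intro i b hi
    rw [hshift] at hi
    have := (hs _).2 ⟨b, hi⟩
    have h1 := s.min'_le _ this
    have h2 := s.le_max' _ this
    constructor <;> linarith
  · obtain ⟨b, hb⟩ := (hs _).1 (s.min'_mem hne)
    exact ⟨b, by rw [hshift]; simpa using hb⟩
  · obtain ⟨b, hb⟩ := (hs _).1 (s.max'_mem hne)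
    exact ⟨b, by rw [hshift]; simpa using hb⟩

/-- The algebraic meaning of `rewrite`: substituting `g x * T ^ w x` for `x` (and `T ^ w t` for `t`)
in `L` amounts to substituting `T ^ i * g x * T ^ (-i)` for `(x, i)` in the rewriting of `L`. -/
lemma conj_lift_mk_eq {Γ : Type*} [Group Γ] (T : Γ) (g : α → Γ) (hg : g t = 1)
    (L : List (α × Bool)) :
    T ^ c * FreeGroup.lift (fun x => g x * T ^ w x) (mk L) =
      FreeGroup.lift (fun p : α × ℤ => T ^ p.2 * g p.1 * T ^ (-p.2)) (mk (rewrite t w c L)) *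
        T ^ (c + weight w L) := by
  induction L generalizing c with
  | nil => simp [← one_eq_mk]
  | cons p L ih =>
    obtain ⟨x, b⟩ := p
    have h1 : mk ((x, b) :: L) = mk [(x, b)] * mk L := by simp
    rw [h1, _root_.map_mul]
    by_cases hx : x = t
    · subst hx
      rw [rewrite_cons_self, weight_cons, ← add_assoc, ← ih, ← mul_assoc]
      congr 1
      cases b <;> simp [hg, zpow_add, zpow_neg]
    · rw [rewrite_cons_of_ne hx, weight_cons, ← add_assoc]
      have h2 : ∀ (q : (α × ℤ) × Bool) (l), mk (q :: l) = mk [q] * mk l := by simp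
      rw [h2, _root_.map_mul, mul_assoc, ← ih, ← mul_assoc, ← mul_assoc]
      congr 1
      cases b <;> simp [zpow_add, zpow_neg, zpow_sub] <;> group

lemma lift_mk_congr {β : Type*} {Γ : Type*} [Group Γ] {f g : β → Γ} {L : List (β × Bool)}
    (h : ∀ p ∈ L, f p.1 = g p.1) : FreeGroup.lift f (mk L) = FreeGroup.lift g (mk L) := by
  rw [lift_mk, lift_mk]
  congr 1
  exact List.map_congr_left fun p hp => by rw [h p hp]

/-- A word whose letters all lie in `S` is a word over the subtype. -/
lemma exists_map_subtype_eq {β : Type*} {S : β → Prop} {L : List (β × Bool)}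
    (h : ∀ p ∈ L, S p.1) :
    ∃ L' : List ({x // S x} × Bool), L'.map (fun p => (p.1.1, p.2)) = L := by
  induction L with
  | nil => exact ⟨[], rfl⟩
  | cons p L ih =>
    obtain ⟨L', hL'⟩ := ih fun q hq => h q (List.mem_cons_of_mem _ hq)
    exact ⟨(⟨p.1, h p List.mem_cons_self⟩, p.2) :: L', by simp [hL']⟩

lemma isReduced_map_iff {β γ : Type*} {f : β → γ} (hf : Function.Injective f)
    {L : List (β × Bool)} :
    IsReduced (L.map fun p => (f p.1, p.2)) ↔ IsReduced L := by
  simp [FreeGroup.IsReduced, List.isChain_map, hf.eq_iff]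

lemma isCyclicallyReduced_map_iff {β γ : Type*} {f : β → γ} (hf : Function.Injective f)
    {L : List (β × Bool)} :
    IsCyclicallyReduced (L.map fun p => (f p.1, p.2)) ↔ IsCyclicallyReduced L := by
  rw [isCyclicallyReduced_iff_append_self, isCyclicallyReduced_iff_append_self, ← List.map_append,
    isReduced_map_iff hf]

/-! ### The HNN extension of a one-relator group -/

/-- The conclusion of the Freiheitssatz for the word `R`: no nontrivial consequence of the relation
`R = 1` avoids a generator that occurs in `R`. Elements of the free group are represented by
reduced words. -/
def IsFreiheit {β : Type u} (R : List (β × Bool)) : Prop :=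
  ∀ z : β, (∃ b, (z, b) ∈ R) → ∀ W : List (β × Bool), FreeGroup.IsReduced W →
    (∀ p ∈ W, p.1 ≠ z) → mk W ∈ Subgroup.normalClosure {mk R} → W = []

/-- A free factor omitting a generator of `R` embeds in the one-relator group. -/
lemma IsFreiheit.injective {β : Type u} {R : List (β × Bool)} (hR : IsFreiheit R)
    {γ : Type*} {f : γ → β} (hf : Function.Injective f)
    {z : β} (hz : ∃ b, (z, b) ∈ R) (hzf : ∀ x, f x ≠ z) :
    Function.Injective
      ((QuotientGroup.mk' (Subgroup.normalClosure {mk R})).comp (FreeGroup.map f)) := by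
  classical
  rw [injective_iff_map_eq_one]
  intro g hg
  rw [MonoidHom.comp_apply, QuotientGroup.mk'_apply, QuotientGroup.eq_one_iff,
    ← mk_toWord (x := g), map.mk] at hg
  have := hR z hz _ ((isReduced_map_iff hf).2 isReduced_toWord) (by
    intro p hp
    obtain ⟨q, -, rfl⟩ := List.mem_map.1 hp
    exact hzf _) hg
  rw [List.map_eq_nil_iff, toWord_eq_nil_iff] at this
  exact this

/-- The one-relator group of `R` embeds in an HNN extension whose stable letter conjugates the free
subgroup on the image of `f₀` to the one on the image of `f₁`. Both subgroups are free on those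
letters by the Freiheitssatz for `R`, so that the isomorphism between them exists. -/
lemma exists_hnn {β γ : Type u} {R : List (β × Bool)} (hR : IsFreiheit R)
    {f₀ f₁ : γ → β} (h₀ : Function.Injective f₀) (h₁ : Function.Injective f₁)
    {z₀ z₁ : β} (hz₀ : ∃ b, (z₀, b) ∈ R) (hz₁ : ∃ b, (z₁, b) ∈ R)
    (hf₀ : ∀ x, f₀ x ≠ z₀) (hf₁ : ∀ x, f₁ x ≠ z₁) :
    ∃ (Γ : Type u) (_ : Group Γ) (T : Γ) (ι : FreeGroup β →* Γ),
      ι.ker = Subgroup.normalClosure {mk R} ∧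
      ∀ x, T * ι (of (f₀ x)) * T⁻¹ = ι (of (f₁ x)) := by
  let φ₀ := (QuotientGroup.mk' (Subgroup.normalClosure {mk R})).comp (FreeGroup.map f₀)
  let φ₁ := (QuotientGroup.mk' (Subgroup.normalClosure {mk R})).comp (FreeGroup.map f₁)
  let e₀ := MonoidHom.ofInjective (f := φ₀) (hR.injective h₀ hz₀ hf₀)
  let e₁ := MonoidHom.ofInjective (f := φ₁) (hR.injective h₁ hz₁ hf₁)
  let φ : φ₀.range ≃* φ₁.range := e₀.symm.trans e₁
  refine ⟨HNNExtension (FreeGroup β ⧸ Subgroup.normalClosure {mk R}) φ₀.range φ₁.range φ,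
    inferInstance, HNNExtension.t,
    HNNExtension.of.comp (QuotientGroup.mk' (Subgroup.normalClosure {mk R})), ?_, ?_⟩
  · ext g
    rw [MonoidHom.mem_ker, MonoidHom.comp_apply,
      map_eq_one_iff _ (HNNExtension.of_injective _), QuotientGroup.mk'_apply,
      QuotientGroup.eq_one_iff]
  · intro x
    have h := HNNExtension.equiv_eq_conj (φ := φ) (e₀ (of x))
    have h2 : ((φ (e₀ (of x)) : φ₁.range) : FreeGroup β ⧸ Subgroup.normalClosure {mk R})
        = φ₁ (of x) :=
      congrArg (fun g => ((e₁ g : φ₁.range) : FreeGroup β ⧸ Subgroup.normalClosure {mk R}))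
        (e₀.symm_apply_apply (of x))
    have h3 : ((e₀ (of x) : φ₀.range) : FreeGroup β ⧸ Subgroup.normalClosure {mk R})
        = φ₀ (of x) := rfl
    rw [h2, h3] at h
    simpa [φ₀, φ₁] using h.symm

/-- The letters of the window: all levels allowed for letters other than `y`, and levels
between `0` and `M` for `y`. -/
def Window {α : Type u} (y : α) (M : ℤ) (p : α × ℤ) : Prop :=
  p.1 = y → 0 ≤ p.2 ∧ p.2 ≤ M

/-- The case of `exists_hnn` in which the stable letter raises levels by one: it is defined on
the letters of the window other than `(y, M)`, and its image consists of those other than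
`(y, 0)`. -/
lemma exists_hnn_window {y : α} {M : ℤ} (hM : 0 ≤ M)
    {R : List ({p // Window y M p} × Bool)} (hR : IsFreiheit R)
    (h0 : ∃ b, (⟨(y, 0), fun _ => ⟨le_rfl, hM⟩⟩, b) ∈ R)
    (h1 : ∃ b, (⟨(y, M), fun _ => ⟨hM, le_rfl⟩⟩, b) ∈ R) :
    ∃ (Γ : Type u) (_ : Group Γ) (T : Γ) (ι : FreeGroup {p // Window y M p} →* Γ),
      ι.ker = Subgroup.normalClosure {mk R} ∧
      ∀ p : {p // Window y M p}, ι (of p) =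
        T ^ p.1.2 * ι (of ⟨(p.1.1, 0), fun _ => ⟨le_rfl, hM⟩⟩) * T ^ (-p.1.2) := by
  let γ := {p : α × ℤ // p.1 = y → 0 ≤ p.2 ∧ p.2 < M}
  let f₀ : γ → {p // Window y M p} := fun p => ⟨p.1, fun h => ⟨(p.2 h).1, (p.2 h).2.le⟩⟩
  let f₁ : γ → {p // Window y M p} := fun p =>
    ⟨(p.1.1, p.1.2 + 1), fun h => ⟨by have := (p.2 h).1; simp only; omega, (p.2 h).2⟩⟩
  have i₀ : Function.Injective f₀ := by
    intro p q h
    have h' := congrArg Subtype.val h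
    exact Subtype.ext h'
  have i₁ : Function.Injective f₁ := by
    intro p q h
    have h' := congrArg Subtype.val h
    simp only [f₁, Prod.mk.injEq, add_left_inj] at h'
    exact Subtype.ext (Prod.ext h'.1 h'.2)
  obtain ⟨Γ, _, T, ι, hker, hT⟩ := exists_hnn hR i₀ i₁ h1 h0
    (by
      rintro ⟨⟨x, i⟩, hp⟩ h
      replace h := congrArg Subtype.val h
      simp only [f₀, Prod.mk.injEq] at h
      have := (hp h.1).2
      simp only at this
      omega)
    (by
      rintro ⟨⟨x, i⟩, hp⟩ h
      replace h := congrArg Subtype.val h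
      simp only [f₁, Prod.mk.injEq] at h
      have := (hp h.1).1
      simp only at this
      omega)
  refine ⟨Γ, inferInstance, T, ι, hker, ?_⟩
  have step : ∀ (x : α) (i : ℤ) (h : Window y M (x, i)) (h' : Window y M (x, i + 1)),
      ι (of ⟨(x, i + 1), h'⟩) = T * ι (of ⟨(x, i), h⟩) * T⁻¹ := by
    intro x i h h'
    exact (hT ⟨(x, i), fun hx => ⟨(h hx).1, (h' hx).2⟩⟩).symm
  rintro ⟨⟨x, i⟩, hp⟩
  induction i using Int.induction_on with
  | zero => simp
  | succ n ih =>
    have hp' : Window y M (x, (n : ℤ)) := fun hx => by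
      have := (hp hx).2
      simp only at this ⊢
      omega
    rw [step x n hp' hp, ih hp']
    simp only [zpow_add, zpow_neg, zpow_one, mul_inv_rev]
    group
  | pred n ih =>
    have hp' : Window y M (x, -(n : ℤ)) := fun hx => by
      have := (hp hx).1
      simp only at this ⊢
      omega
    have h := step x (-(n : ℤ) - 1) hp (by simpa using hp')
    have h2 : ι (of ⟨(x, -(n : ℤ)), hp'⟩) = T * ι (of ⟨(x, -(n : ℤ) - 1), hp⟩) * T⁻¹ := by
      rw [← h]
      simp
    rw [ih hp'] at h2
    have h3 : ι (of ⟨(x, -(n : ℤ) - 1), hp⟩) =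
        T⁻¹ * (T * ι (of ⟨(x, -(n : ℤ) - 1), hp⟩) * T⁻¹) * T := by group
    rw [h3, ← h2]
    simp only [zpow_neg, zpow_one, zpow_add, sub_eq_add_neg, neg_add, neg_neg]
    group

/-- Consequences of `L` descend to consequences of its rewriting `R`: if `W` lies in the normal
closure of `L`, then its rewriting `V` lies in the normal closure of `R`, already in the free group
on the window. Both `L` and `W` are evaluated in the HNN extension, in which the one-relator group
of `R` embeds. -/
theorem mem_normalClosure_of_rewrite {t y : α} {w : α → ℤ} {c M : ℤ} (hM : 0 ≤ M)
    {L : List (α × Bool)} (h0 : weight w L = 0)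
    {R : List ({p // Window y M p} × Bool)} (hR : IsFreiheit R)
    (hRL : R.map (fun p => (p.1.1, p.2)) = rewrite t w c L)
    (hy0 : ∃ b, ((y, 0), b) ∈ rewrite t w c L) (hyM : ∃ b, ((y, M), b) ∈ rewrite t w c L)
    {W : List (α × Bool)} (hW : mk W ∈ Subgroup.normalClosure {mk L})
    {d : ℤ} {V : List ({p // Window y M p} × Bool)}
    (hV : V.map (fun p => (p.1.1, p.2)) = rewrite t w d W) :
    mk V ∈ Subgroup.normalClosure {mk R} := by
  have mem : ∀ q : {p // Window y M p}, (∃ b, (q.1, b) ∈ rewrite t w c L) → ∃ b, (q, b) ∈ R := by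
    rintro q ⟨b, hb⟩
    rw [← hRL, List.mem_map] at hb
    obtain ⟨r, hr, he⟩ := hb
    simp only [Prod.mk.injEq] at he
    refine ⟨r.2, ?_⟩
    rw [← Subtype.ext he.1]
    exact hr
  obtain ⟨Γ, _, T, ι, hker, hT⟩ := exists_hnn_window hM hR (mem _ hy0) (mem _ hyM)
  classical
  -- `θ` sends `t` to a power of `T` and twists the other generators by powers of `T`; words of
  -- weight zero are sent to conjugates of the values of their rewritings under `ι`.
  let g : α → Γ := fun x => if x = t then 1 else ι (of ⟨(x, 0), fun _ => ⟨le_rfl, hM⟩⟩)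
  let θ := FreeGroup.lift (fun x => g x * T ^ w x)
  have key : ∀ (e : ℤ) (U : List (α × Bool)) (U' : List ({p // Window y M p} × Bool)),
      U'.map (fun p => (p.1.1, p.2)) = rewrite t w e U →
      T ^ e * θ (mk U) = ι (mk U') * T ^ (e + weight w U) := by
    intro e U U' hU
    have hg : g t = 1 := if_pos rfl
    rw [conj_lift_mk_eq T g hg, ← hU, ← map.mk (f := Subtype.val)]
    congr 1
    have e1 : (FreeGroup.lift fun p : α × ℤ => T ^ p.2 * g p.1 * T ^ (-p.2)).comp
        (FreeGroup.map Subtype.val) = FreeGroup.lift (fun p : {p // Window y M p} =>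
          T ^ p.1.2 * g p.1.1 * T ^ (-p.1.2)) := by
      ext p; simp
    rw [← MonoidHom.comp_apply, e1, lift_unique (f := fun p => ι (of p)) ι fun _ => rfl]
    apply lift_mk_congr
    intro p hp
    have hpt : p.1.1.1 ≠ t := by
      apply ne_of_mem_rewrite (t := t) (w := w) (c := e) (L := U) (p := (p.1.1, p.2))
      rw [← hU]
      exact List.mem_map_of_mem (f := fun p => (p.1.1, p.2)) hp
    rw [hT p.1]
    simp [g, hpt]
  have hL : θ (mk L) = 1 := by
    have h := key c L R hRL
    have hR1 : ι (mk R) = 1 := by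
      rw [← MonoidHom.mem_ker, hker]
      exact Subgroup.subset_normalClosure rfl
    rw [hR1, h0, add_zero, one_mul] at h
    simpa using h
  have hθW : θ (mk W) = 1 := by
    have : Subgroup.normalClosure {mk L} ≤ θ.ker := by
      apply Subgroup.normalClosure_le_normal
      rintro _ rfl
      exact hL
    exact this hW
  have hW0 : weight w W = 0 := by
    have := dvd_weight_of_mem_normalClosure (w := w) hW
    rwa [h0, zero_dvd_iff] at this
  have h := key d W V hV
  rw [hθW, hW0, add_zero, mul_one] at h
  rw [← hker, MonoidHom.mem_ker]
  simpa using h.symm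

/-! ### The Freiheitssatz -/

/-- A rewriting whose levels of `y` lie between `0` and `M` is a word over the window. -/
lemma exists_window_word {t y : α} {w : α → ℤ} {c M : ℤ} {L : List (α × Bool)}
    (h : ∀ i b, ((y, i), b) ∈ rewrite t w c L → 0 ≤ i ∧ i ≤ M) :
    ∃ R : List ({p // Window y M p} × Bool),
      R.map (fun p => (p.1.1, p.2)) = rewrite t w c L := by
  apply exists_map_subtype_eq
  rintro ⟨⟨x, i⟩, b⟩ hp rfl
  exact h i b hp

/-- The data of the inductive step: a rewriting of `L` as a shorter cyclically reduced word over a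
window in which both extreme letters `(y, 0)` and `(y, M)` are used. -/
lemma exists_windowed_rewrite {t y : α} {w : α → ℤ} (ht : w t ≠ 0) (hyt : y ≠ t)
    {L : List (α × Bool)} (hL : IsCyclicallyReduced L) (h0 : weight w L = 0)
    (htL : ∃ b, (t, b) ∈ L) (hyL : ∃ b, (y, b) ∈ L) :
    ∃ (c M : ℤ) (R : List ({p // Window y M p} × Bool)), 0 ≤ M ∧
      R.map (fun p => (p.1.1, p.2)) = rewrite t w c L ∧
      (∃ b, ((y, 0), b) ∈ rewrite t w c L) ∧ (∃ b, ((y, M), b) ∈ rewrite t w c L) ∧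
      IsCyclicallyReduced R ∧ R.length < L.length := by
  obtain ⟨bt, hbt⟩ := htL
  obtain ⟨b, hb⟩ := hyL
  obtain ⟨c, M, hwin, hy0, hyM⟩ := exists_normalized_level w hyt hb
  obtain ⟨R, hR⟩ := exists_window_word hwin
  refine ⟨c, M, R, (hwin _ _ hy0.choose_spec).2, hR, hy0, hyM, ?_, ?_⟩
  · rw [← isCyclicallyReduced_map_iff Subtype.val_injective, hR]
    exact isCyclicallyReduced_rewrite ht hL h0
  · have h := congrArg List.length hR
    rw [List.length_map] at h
    rw [h]
    exact length_rewrite_lt hbt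

lemma exists_mem_of_map_subtype_eq {β : Type*} {S : β → Prop} {R : List ({x // S x} × Bool)}
    {L : List (β × Bool)} (h : R.map (fun p => (p.1.1, p.2)) = L) {z : β} {b : Bool}
    (hz : (z, b) ∈ L) : ∃ hS : S z, (⟨z, hS⟩, b) ∈ R := by
  rw [← h, List.mem_map] at hz
  obtain ⟨⟨⟨x, hx⟩, b⟩, hp, he⟩ := hz
  simp only [Prod.mk.injEq] at he
  obtain ⟨rfl, rfl⟩ := he
  exact ⟨hx, hp⟩

lemma isFreiheit_of_forall_eq {y : α} {L : List (α × Bool)} (h : ∀ p ∈ L, p.1 = y) :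
    IsFreiheit L := by
  classical
  rintro z ⟨b, hb⟩ W hW hWz hmem
  obtain rfl : z = y := h _ hb
  -- The endomorphism killing the only letter of `L` fixes `W`.
  let f : FreeGroup α →* FreeGroup α := FreeGroup.lift fun x => if x = z then 1 else of x
  have hL : f (mk L) = 1 := by
    have : f (mk L) = FreeGroup.lift (fun _ => (1 : FreeGroup α)) (mk L) :=
      lift_mk_congr fun p hp => by simp [h p hp]
    rw [this, lift_mk]
    apply List.prod_eq_one
    intro x hx
    obtain ⟨p, -, rfl⟩ := List.mem_map.1 hx
    cases p.2 <;> simp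
  have hfW : f (mk W) = mk W := by
    conv_rhs => rw [← lift_of_apply (mk W)]
    exact lift_mk_congr fun p hp => by simp [hWz p hp]
  have hker : Subgroup.normalClosure {mk L} ≤ f.ker := by
    apply Subgroup.normalClosure_le_normal
    rintro _ rfl
    exact hL
  have h1 : mk W = 1 := hfW.symm.trans (hker hmem)
  rw [← toWord_eq_nil_iff, toWord_mk, hW.reduce_eq] at h1
  exact h1

open Classical in
/-- A weight supported on `t` and `y` that vanishes on `L`; on `t` it is minus the exponent sum of
`y`. -/
lemma exists_weight_eq_zero (t y : α) (hyt : y ≠ t) (L : List (α × Bool)) :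
    ∃ w : α → ℤ, w t = -weight (Pi.single y 1) L ∧ weight w L = 0 := by
  refine ⟨fun x => -weight (Pi.single y 1) L * (Pi.single t 1 : α → ℤ) x +
    weight (Pi.single t 1) L * (Pi.single y 1 : α → ℤ) x, ?_, ?_⟩
  · simp [hyt.symm]
  · rw [weight_linear]; ring

/-- If `t` is the only letter of nonzero weight, then a reduced word not ending with `t ^ ± 1`
all of whose recorded levels are the initial one does not involve `t`. -/
lemma notMem_of_forall_level_eq {t : α} {w : α → ℤ} (ht : w t ≠ 0)
    (hw : ∀ x, x ≠ t → w x = 0) {d : ℤ} {x : α} (hx : x ≠ t) {b : Bool} {L : List (α × Bool)}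
    (hL : FreeGroup.IsReduced (L ++ [(x, b)]))
    (h : ∀ p ∈ rewrite t w d (L ++ [(x, b)]), p.1.2 = d) : ∀ b, (t, b) ∉ L := by
  induction L with
  | nil => simp
  | cons q L ih =>
    obtain ⟨z, b'⟩ := q
    by_cases hz : z = t
    · subst hz
      exfalso
      obtain ⟨i, hi⟩ := exists_mem_rewrite (t := z) (w := w) (c := d)
        (L := (z, b') :: L ++ [(x, b)]) (p := (x, b)) (by simp) hx
      obtain ⟨p, hp⟩ := Option.isSome_iff_exists.1
        (List.isSome_head?.2 (List.ne_nil_of_mem hi))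
      have h1 := level_head_rewrite_cons_self ht hL hp
      have h2 := List.mem_of_mem_head? hp
      apply h1
      rw [hw _ (ne_of_mem_rewrite h2), h p h2]
      cases p.2 <;> simp
    · rw [List.cons_append, rewrite_cons_of_ne hz, hw z hz] at h
      have h' : ∀ p ∈ rewrite t w d (L ++ [(x, b)]), p.1.2 = d := by
        intro p hp
        apply h
        apply List.mem_cons_of_mem
        cases b' <;> simpa using hp
      intro b'' hb
      rcases List.mem_cons.1 hb with hb | hb
      · exact hz (Prod.ext_iff.1 hb).1.symm
      · exact ih (isReduced_cons_iff.1 hL).2 h' _ hb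

/-- If `t` is the only letter of nonzero weight, and it occurs in the cyclically reduced word `L`
with exponent sum zero, then the recorded levels of `L` are not all equal. -/
lemma exists_level_ne {t : α} {w : α → ℤ} (ht : w t ≠ 0) (hw : ∀ x, x ≠ t → w x = 0)
    {L : List (α × Bool)} (hL : IsCyclicallyReduced L) (h0 : weight w L = 0)
    {b : Bool} (hb : (t, b) ∈ L) {a : α} (ha : a ≠ t) {b' : Bool} (hb' : (a, b') ∈ L)
    (c d : ℤ) : ∃ p ∈ rewrite t w c L, p.1.2 ≠ d := by
  by_contra! hcon
  obtain ⟨L₁, L₂, rfl⟩ := List.append_of_mem hb'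
  have hred : FreeGroup.IsReduced (((a, b') :: L₂ ++ L₁) ++ [(a, b')]) := by
    rw [isCyclicallyReduced_iff_append_self] at hL
    exact hL.infix ⟨L₁, L₂, by simp⟩
  have hlev : c + weight w L₁ = d := by
    have := hcon ((a, c + weight w L₁), b') (by
      rw [rewrite_append, rewrite_cons_of_ne ha, hw a ha]
      apply List.mem_append_right
      cases b' <;> simp)
    exact this
  have hall : ∀ p ∈ rewrite t w d (((a, b') :: L₂ ++ L₁) ++ [(a, b')]), p.1.2 = d := by
    have h2 : rewrite t w c ((L₁ ++ (a, b') :: L₂) ++ (L₁ ++ (a, b') :: L₂)) =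
        rewrite t w c (L₁ ++ (a, b') :: L₂) ++ rewrite t w c (L₁ ++ (a, b') :: L₂) := by
      rw [rewrite_append, h0, add_zero]
    -- Since `L` has weight zero, the rotation of `L` starting and ending with `a` is a subword of
    -- `L ++ L` whose recorded levels are those of `L`.
    have h3 : (L₁ ++ (a, b') :: L₂) ++ (L₁ ++ (a, b') :: L₂) =
        L₁ ++ (((a, b') :: L₂ ++ L₁) ++ [(a, b')]) ++ L₂ := by simp
    rw [h3, rewrite_append, rewrite_append, hlev] at h2
    intro p hp
    have h4 := List.mem_append_left
      (rewrite t w (c + weight w (L₁ ++ ((a, b') :: L₂ ++ L₁ ++ [(a, b')]))) L₂)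
      (List.mem_append_right (rewrite t w c L₁) hp)
    rw [h2, List.mem_append, or_self] at h4
    exact hcon p h4
  have := notMem_of_forall_level_eq ht hw ha hred hall b
  apply this
  simp only [List.mem_append, List.mem_cons] at hb ⊢
  tauto

/-- **Freiheitssatz** of Magnus: a cyclically reduced word `L` has no nontrivial consequence that
avoids a generator occurring in `L`. -/
theorem isFreiheit_of_isCyclicallyReduced {L : List (α × Bool)} (hL : IsCyclicallyReduced L) :
    IsFreiheit L := by
  classical
  induction hn : L.length using Nat.strong_induction_on generalizing α with
  | _ n IH =>
    subst hn
    rintro y ⟨bz₀, hby⟩ W hW hWy hmem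
    by_cases hall : ∀ p ∈ L, p.1 = y
    · exact isFreiheit_of_forall_eq hall y ⟨bz₀, hby⟩ W hW hWy hmem
    push Not at hall
    obtain ⟨⟨a, ba⟩, ha, hay⟩ := hall
    simp only at hay
    by_cases hexp : weight (Pi.single y 1) L = 0
    -- The letter `y` has exponent sum zero and is taken as the stable letter. The word `W` has all
    -- its levels equal to `0`, whereas the rewriting of `L` involves a letter of another level.
    · let w : α → ℤ := Pi.single y 1
      have hwy : w y ≠ 0 := by simp [w]
      have hw : ∀ x, x ≠ y → w x = 0 := fun x hx => by simp [w, hx]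
      have hW0 : weight w W = 0 := by
        have := dvd_weight_of_mem_normalClosure (w := w) hmem
        rwa [hexp, zero_dvd_iff] at this
      obtain ⟨c, M, R, hM, hR, ha0, haM, hRc, hlen⟩ :=
        exists_windowed_rewrite hwy hay hL hexp ⟨_, hby⟩ ⟨_, ha⟩
      have hF := IH _ hlen hRc rfl
      have hlevW : ∀ (V : List (α × Bool)), (∀ p ∈ V, p.1 ≠ y) →
          ∀ p ∈ rewrite y w 0 V, p.1.2 = 0 := by
        intro V
        induction V with
        | nil => simp
        | cons q V ih =>
          intro hV p hp
          have hq : q.1 ≠ y := hV q List.mem_cons_self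
          rw [show q = (q.1, q.2) from rfl, rewrite_cons_of_ne hq, hw _ hq, List.mem_cons] at hp
          rcases hp with rfl | hp
          · cases q.2 <;> simp
          · apply ih (fun r hr => hV r (List.mem_cons_of_mem _ hr))
            cases h : q.2 <;> simpa [h] using hp
      obtain ⟨V, hV⟩ := exists_window_word (t := y) (y := a) (w := w) (c := 0) (M := M) (L := W)
        (fun i b hi => by
          have := hlevW W hWy _ hi
          simp only at this
          omega)
      have hVmem := mem_normalClosure_of_rewrite hM hexp hF hR ha0 haM hmem hV
      obtain ⟨⟨z, bz⟩, hz, hz0⟩ := exists_level_ne hwy hw hL hexp hby hay ha c 0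
      obtain ⟨hS, hzR⟩ := exists_mem_of_map_subtype_eq hR hz
      have hVr : FreeGroup.IsReduced V := by
        rw [← isReduced_map_iff Subtype.val_injective, hV]
        exact isReduced_rewrite hwy hW
      have hVnil := hF _ ⟨_, hzR⟩ V hVr (by
        rintro ⟨_, b⟩ hp rfl
        apply hz0
        apply hlevW W hWy (z, b)
        rw [← hV]
        exact List.mem_map_of_mem (f := fun p => (p.1.1, p.2)) hp) hVmem
      rw [hVnil] at hV
      exact eq_nil_of_rewrite_eq_nil hwy hW hW0 hV.symm
    -- Here another letter `a` of `L` is taken as the stable letter. The rewriting of `W` avoids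
    -- `y` at every level, whereas the rewriting of `L` involves `(y, 0)`.
    · obtain ⟨w, hwa, hwL⟩ := exists_weight_eq_zero a y hay.symm L
      have hwa0 : w a ≠ 0 := by rw [hwa]; simpa using hexp
      have hW0 : weight w W = 0 := by
        have := dvd_weight_of_mem_normalClosure (w := w) hmem
        rwa [hwL, zero_dvd_iff] at this
      obtain ⟨c, M, R, hM, hR, hy0, hyM, hRc, hlen⟩ :=
        exists_windowed_rewrite hwa0 hay.symm hL hwL ⟨_, ha⟩ ⟨_, hby⟩
      have hF := IH _ hlen hRc rfl
      have hyW : ∀ i b, ((y, i), b) ∉ rewrite a w 0 W := fun i b hi =>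
        hWy _ (mem_of_mem_rewrite hi) rfl
      obtain ⟨V, hV⟩ := exists_window_word (t := a) (y := y) (w := w) (c := 0) (M := M) (L := W)
        (fun i b hi => absurd hi (hyW i b))
      have hVmem := mem_normalClosure_of_rewrite hM hwL hF hR hy0 hyM hmem hV
      obtain ⟨bz, hz⟩ := hy0
      obtain ⟨hS, hzR⟩ := exists_mem_of_map_subtype_eq hR hz
      have hVr : FreeGroup.IsReduced V := by
        rw [← isReduced_map_iff Subtype.val_injective, hV]
        exact isReduced_rewrite hwa0 hW
      have hVnil := hF _ ⟨_, hzR⟩ V hVr (by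
        rintro ⟨_, b⟩ hp rfl
        apply hyW 0 b
        rw [← hV]
        exact List.mem_map_of_mem (f := fun p => (p.1.1, p.2)) hp) hVmem
      rw [hVnil] at hV
      exact eq_nil_of_rewrite_eq_nil hwa0 hW hW0 hV.symm

/-! ### Conjugate words and cyclic permutations -/

lemma isReduced_invRev {L : List (α × Bool)} (hL : FreeGroup.IsReduced L) :
    FreeGroup.IsReduced (invRev L) := by
  classical
  rw [isReduced_iff_reduce_eq, reduce_invRev, hL.reduce_eq]

lemma isCyclicallyReduced_invRev {L : List (α × Bool)} (hL : IsCyclicallyReduced L) :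
    IsCyclicallyReduced (invRev L) := by
  rw [isCyclicallyReduced_iff_append_self] at hL ⊢
  rw [← invRev_append]
  exact isReduced_invRev hL

lemma isCyclicallyReduced_append_comm {L₁ L₂ : List (α × Bool)}
    (h : IsCyclicallyReduced (L₁ ++ L₂)) : IsCyclicallyReduced (L₂ ++ L₁) := by
  by_cases h0 : L₂ ++ L₁ = []
  · rw [h0]; exact .nil
  have h3 := h.flatten_replicate 3
  rw [isCyclicallyReduced_iff_append_self]
  exact h3.isReduced.infix ⟨L₁, L₂, by simp [List.replicate_succ]⟩

lemma eq_of_mk_eq {L₁ L₂ : List (α × Bool)} (h₁ : FreeGroup.IsReduced L₁)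
    (h₂ : FreeGroup.IsReduced L₂) (h : mk L₁ = mk L₂) : L₁ = L₂ := by
  classical
  rw [← h₁.reduce_eq, ← h₂.reduce_eq, reduce.sound h]

lemma mk_cons (p : α × Bool) (L : List (α × Bool)) : mk (p :: L) = mk [p] * mk L := by simp

/-- Conjugate cyclically reduced words are cyclic permutations of each other. -/
theorem isRotated_of_isConj {L₁ L₂ : List (α × Bool)} (h₁ : IsCyclicallyReduced L₁)
    (h₂ : IsCyclicallyReduced L₂) (h : IsConj (mk L₂) (mk L₁)) : L₁ ~r L₂ := by
  classical
  obtain ⟨g, hg⟩ := isConj_iff.1 h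
  rw [← mk_toWord (x := g)] at hg
  have hV : FreeGroup.IsReduced g.toWord := isReduced_toWord
  generalize g.toWord = V at hg hV
  clear h g
  induction V using List.reverseRecOn generalizing L₂ with
  | nil =>
    rw [← one_eq_mk, one_mul, inv_one, mul_one] at hg
    rw [eq_of_mk_eq h₁.isReduced h₂.isReduced hg.symm]
  | append_singleton V p ih =>
    obtain ⟨x, b⟩ := p
    have hV' : FreeGroup.IsReduced V := hV.infix ⟨[], [(x, b)], by simp⟩
    have hinv : mk [(x, !b)] = (mk [(x, b)])⁻¹ := by simp [inv_mk, invRev]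
    rcases L₂ with _ | ⟨q, L₂⟩
    · rw [← one_eq_mk, mul_one, mul_inv_cancel] at hg
      rw [eq_of_mk_eq h₁.isReduced IsReduced.nil hg.symm]
    by_cases hq : q = (x, !b)
    · subst hq
      have hrot := ih (L₂ := L₂ ++ [(x, !b)])
        (isCyclicallyReduced_append_comm (L₁ := [(x, !b)]) h₂) (by
          rw [← hg, ← mul_mk, ← mul_mk, mk_cons _ L₂, hinv]; group) hV'
      exact hrot.trans ⟨L₂.length, by simp⟩
    by_cases hl : ∃ L, q :: L₂ = L ++ [(x, b)]
    · obtain ⟨L, hL⟩ := hl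
      rw [hL] at hg h₂ ⊢
      have hrot := ih (L₂ := (x, b) :: L)
        (isCyclicallyReduced_append_comm (L₂ := [(x, b)]) h₂) (by
          rw [← hg, ← mul_mk, ← mul_mk, mk_cons]; group) hV'
      exact hrot.trans ⟨1, by simp⟩
    · exfalso
      -- Nothing cancels in the conjugate, so that it is a reduced word but not a cyclically reduced
      -- one, in contradiction with `h₁`.
      have hr : FreeGroup.IsReduced ((V ++ [(x, b)]) ++ (q :: L₂) ++ invRev (V ++ [(x, b)])) := by
        refine IsReduced.append_overlap ?_ ?_ (by simp)
        · refine List.isChain_append.2 ⟨hV, h₂.isReduced, ?_⟩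
          rintro a ha a' ha' he
          simp only [List.getLast?_append, List.getLast?_singleton, Option.some_or,
            Option.mem_def, Option.some.injEq, List.head?_cons] at ha ha'
          subst ha ha'
          by_contra hne
          apply hq
          refine Prod.ext he.symm ?_
          revert hne
          cases b <;> cases q.2 <;> simp
        · refine List.isChain_append.2 ⟨h₂.isReduced, isReduced_invRev hV, ?_⟩
          rintro a ha a' ha' he
          rw [invRev_append] at ha'
          simp only [invRev, List.map_cons, List.map_nil, List.reverse_cons, List.reverse_nil,
            List.nil_append, List.cons_append, List.head?_cons, Option.mem_def,
            Option.some.injEq] at ha'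
          subst ha'
          by_contra hne
          apply hl
          obtain ⟨L, hL⟩ := List.getLast?_eq_some_iff.1 ha
          refine ⟨L, ?_⟩
          rw [hL]
          congr 2
          refine Prod.ext he ?_
          revert hne
          cases b <;> cases a.2 <;> simp
      have heq := eq_of_mk_eq h₁.isReduced hr (by
        rw [← mul_mk, ← mul_mk, ← inv_mk, hg])
      obtain ⟨p₀, V', hp₀⟩ : ∃ p₀ V', V ++ [(x, b)] = p₀ :: V' :=
        List.exists_cons_of_ne_nil (by simp)
      rw [hp₀, invRev_cons, ← List.append_assoc] at heq
      have : IsCyclicallyReduced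
          (p₀ :: (V' ++ q :: L₂ ++ invRev V') ++ [(p₀.1, !p₀.2)]) := by
        convert h₁ using 1
        rw [heq]
        simp [invRev]
      rw [isCyclicallyReduced_cons_append_iff] at this
      simpa using this.2

lemma mk_rewrite_eq_of_step {W W' : List (α × Bool)} (h : Red.Step W W') :
    mk (rewrite t w c W) = mk (rewrite t w c W') := by
  obtain ⟨⟩ := h
  rename_i L₁ L₂ x b
  rw [rewrite_append, rewrite_append, ← mul_mk, ← mul_mk]
  congr 1
  by_cases hx : x = t
  · subst hx
    rw [rewrite_cons_self, rewrite_cons_self]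
    cases b <;> simp
  · rw [rewrite_cons_of_ne hx, rewrite_cons_of_ne hx]
    apply Quot.sound
    cases b
    · simpa [sub_eq_add_neg] using Red.Step.cons_not (b := false)
    · simpa using Red.Step.cons_not (b := true)

lemma mk_rewrite_eq_of_mk_eq {W W' : List (α × Bool)} (h : mk W = mk W') :
    mk (rewrite t w c W) = mk (rewrite t w c W') := by
  have key : ∀ {U U' : List (α × Bool)}, Red U U' →
      mk (rewrite t w c U) = mk (rewrite t w c U') := by
    intro U U' hU
    induction hU with
    | refl => rfl
    | tail _ h ih => rw [ih, mk_rewrite_eq_of_step h]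
  obtain ⟨U, hU, hU'⟩ := Red.exact.1 h
  rw [key hU, key hU']

lemma weight_eq_of_mk_eq {W W' : List (α × Bool)} (h : mk W = mk W') :
    weight w W = weight w W' := by
  apply Multiplicative.ofAdd.injective
  rw [← lift_ofAdd_mk, ← lift_ofAdd_mk, h]

/-- A word is determined in the free group by its weight and its rewriting. -/
lemma mk_eq_of_rewrite_eq (ht : w t ≠ 0) {L₁ L₂ : List (α × Bool)}
    (hw : weight w L₁ = weight w L₂) (h : rewrite t w c L₁ = rewrite t w c L₂) :
    mk L₁ = mk L₂ := by
  classical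
  rw [← mul_inv_eq_one, inv_mk, mul_mk]
  have h1 : mk (rewrite t w c (L₁ ++ invRev L₂)) = 1 := by
    rw [rewrite_append, rewrite_invRev, hw, add_sub_cancel_right, ← mul_mk, ← inv_mk, h,
      mul_inv_cancel]
  have h0 : weight w (L₁ ++ invRev L₂) = 0 := by
    rw [weight_append, weight_invRev, hw, add_neg_cancel]
  generalize L₁ ++ invRev L₂ = W at h1 h0
  have hmk : mk (reduce W) = mk W := reduce.self
  rw [mk_rewrite_eq_of_mk_eq hmk.symm] at h1
  rw [weight_eq_of_mk_eq hmk.symm] at h0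
  have hr : FreeGroup.IsReduced (reduce W) := by rw [isReduced_iff_reduce_eq, reduce.idem]
  have hnil := eq_of_mk_eq (isReduced_rewrite ht hr) IsReduced.nil h1
  rw [← hmk, eq_nil_of_rewrite_eq_nil ht hr h0 hnil]
  rfl

lemma exists_split_of_rewrite_eq {L : List (α × Bool)} {A B : List ((α × ℤ) × Bool)}
    {q : (α × ℤ) × Bool} (h : rewrite t w c L = A ++ q :: B) :
    ∃ (P S : List (α × Bool)), L = P ++ (q.1.1, q.2) :: S ∧ rewrite t w c P = A ∧
      rewrite t w (c + weight w P) ((q.1.1, q.2) :: S) = q :: B := by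
  induction L generalizing c A with
  | nil => simp at h
  | cons p L ih =>
    obtain ⟨x, b⟩ := p
    by_cases hx : x = t
    · subst hx
      rw [rewrite_cons_self] at h
      obtain ⟨P, S, rfl, hP, hS⟩ := ih h
      refine ⟨(x, b) :: P, S, rfl, by rw [rewrite_cons_self, hP], ?_⟩
      rw [weight_cons, ← add_assoc, hS]
    · rcases A with _ | ⟨a, A⟩
      · have h' := h
        rw [rewrite_cons_of_ne hx, List.nil_append, List.cons.injEq] at h'
        obtain ⟨rfl, -⟩ := h'
        exact ⟨[], L, rfl, rfl, by simpa using h⟩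
      · rw [rewrite_cons_of_ne hx, List.cons_append, List.cons.injEq] at h
        obtain ⟨P, S, rfl, hP, hS⟩ := ih h.2
        refine ⟨(x, b) :: P, S, rfl, by rw [rewrite_cons_of_ne hx, hP, h.1], ?_⟩
        rw [weight_cons, ← add_assoc, hS]

/-- Every cyclic permutation of the rewriting of a word of weight zero is the rewriting of a
conjugate word, with an initial level that depends only on the first letter. -/
lemma exists_isConj_of_rewrite_eq {L : List (α × Bool)} (h0 : weight w L = 0)
    {A B : List ((α × ℤ) × Bool)} {q : (α × ℤ) × Bool} (h : rewrite t w c L = A ++ q :: B) :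
    ∃ L', IsConj (mk L) (mk L') ∧ weight w L' = 0 ∧
      rewrite t w (cond q.2 q.1.2 (q.1.2 + w q.1.1)) L' = q :: (B ++ A) := by
  obtain ⟨P, S, rfl, hP, hS⟩ := exists_split_of_rewrite_eq h
  have hqt : q.1.1 ≠ t := by
    apply ne_of_mem_rewrite (t := t) (w := w) (c := c) (p := q)
    rw [h]
    simp
  have hc : c + weight w P = cond q.2 q.1.2 (q.1.2 + w q.1.1) := by
    rw [rewrite_cons_of_ne hqt, List.cons.injEq] at hS
    have := congrArg (fun q => q.1.2) hS.1
    simp only at this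
    rw [← this]
    cases q.2 <;> simp
  have h0' : weight w ((q.1.1, q.2) :: S) = -weight w P := by
    rw [weight_append] at h0
    linarith
  refine ⟨(q.1.1, q.2) :: S ++ P, ?_, ?_, ?_⟩
  · rw [← mul_mk, ← mul_mk]
    exact isConj_iff.2 ⟨(mk P)⁻¹, by group⟩
  · rw [weight_append, h0', neg_add_cancel]
  · rw [rewrite_append, h0', ← hc, hS, add_neg_cancel_right, hP, List.cons_append]

/-- Words of weight zero whose rewritings are cyclic permutations of each other are conjugate. -/
theorem isConj_of_isRotated_rewrite (ht : w t ≠ 0) {L₁ L₂ : List (α × Bool)}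
    (h₁ : weight w L₁ = 0) (h₂ : weight w L₂ = 0) {c₁ c₂ : ℤ}
    (hne : rewrite t w c₁ L₁ ≠ [])
    (h : rewrite t w c₁ L₁ ~r rewrite t w c₂ L₂) : IsConj (mk L₁) (mk L₂) := by
  obtain ⟨q, B, hB⟩ := List.exists_cons_of_ne_nil hne
  have hsplit : ∃ A C, rewrite t w c₂ L₂ = A ++ q :: C ∧ C ++ A = B := by
    obtain ⟨n, hn, hrot⟩ := List.isRotated_iff_mod.1 h
    rw [List.rotate_eq_drop_append_take hn, hB] at hrot
    rcases n with _ | n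
    · exact ⟨[], B, by simpa using hrot.symm, by simp⟩
    · exact ⟨B.drop n, B.take n, by simpa using hrot.symm, by simp⟩
  obtain ⟨A, C, hA, rfl⟩ := hsplit
  obtain ⟨L₁', hc₁, hw₁, hr₁⟩ := exists_isConj_of_rewrite_eq (A := []) h₁ hB
  obtain ⟨L₂', hc₂, hw₂, hr₂⟩ := exists_isConj_of_rewrite_eq h₂ hA
  rw [List.append_nil, ← hr₂] at hr₁
  rw [mk_eq_of_rewrite_eq ht (hw₁.trans hw₂.symm) hr₁] at hc₁
  exact hc₁.trans hc₂.symm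

/-! ### Magnus's conjugacy theorem -/

/-- The interval of levels of `y` cannot be shorter for a consequence `L₂` of `L₁` than for `L₁`:
otherwise `L₂` would give a consequence of `R₁` avoiding `(y, M₁)`. -/
lemma window_le {y : α} (ht : w t ≠ 0) {L₁ L₂ : List (α × Bool)} (h0 : weight w L₁ = 0)
    (hL₂ : IsCyclicallyReduced L₂) (hne : L₂ ≠ [])
    (hmem : mk L₂ ∈ Subgroup.normalClosure {mk L₁}) {c₁ c₂ M₁ M₂ : ℤ} (hM₁ : 0 ≤ M₁)
    {R₁ : List ({p // Window y M₁ p} × Bool)} (hR₁ : IsFreiheit R₁)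
    (hRL₁ : R₁.map (fun p => (p.1.1, p.2)) = rewrite t w c₁ L₁)
    (hy0 : ∃ b, ((y, 0), b) ∈ rewrite t w c₁ L₁) (hyM : ∃ b, ((y, M₁), b) ∈ rewrite t w c₁ L₁)
    {R₂ : List ({p // Window y M₂ p} × Bool)}
    (hRL₂ : R₂.map (fun p => (p.1.1, p.2)) = rewrite t w c₂ L₂) : M₁ ≤ M₂ := by
  by_contra! hlt
  have hwin : ∀ i b, ((y, i), b) ∈ rewrite t w c₂ L₂ → 0 ≤ i ∧ i ≤ M₂ := by
    intro i b hi
    obtain ⟨hS, -⟩ := exists_mem_of_map_subtype_eq hRL₂ hi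
    exact hS rfl
  obtain ⟨V, hV⟩ := exists_window_word (t := t) (w := w) (M := M₁) (c := c₂) (y := y) (L := L₂)
    fun i b hi => ⟨(hwin i b hi).1, (hwin i b hi).2.trans hlt.le⟩
  have hVmem := mem_normalClosure_of_rewrite hM₁ h0 hR₁ hRL₁ hy0 hyM hmem hV
  obtain ⟨bz, hz⟩ := hyM
  obtain ⟨hS, hzR⟩ := exists_mem_of_map_subtype_eq hRL₁ hz
  have hVr : FreeGroup.IsReduced V := by
    rw [← isReduced_map_iff Subtype.val_injective, hV]
    exact isReduced_rewrite ht hL₂.isReduced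
  have hVnil := hR₁ _ ⟨_, hzR⟩ V hVr (by
    rintro ⟨_, b⟩ hp rfl
    have : ((y, M₁), b) ∈ rewrite t w c₂ L₂ := by
      rw [← hV]
      exact List.mem_map_of_mem (f := fun p => (p.1.1, p.2)) hp
    exact absurd (hwin _ _ this).2 (not_le.2 hlt)) hVmem
  have h02 : weight w L₂ = 0 := by
    have := dvd_weight_of_mem_normalClosure (w := w) hmem
    rwa [h0, zero_dvd_iff] at this
  rw [hVnil] at hV
  exact hne (eq_nil_of_rewrite_eq_nil ht hL₂.isReduced h02 hV.symm)

lemma mk_eq_zpow_of_forall_eq [DecidableEq α] {y : α} {L : List (α × Bool)}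
    (h : ∀ p ∈ L, p.1 = y) : mk L = of y ^ weight (Pi.single y 1) L := by
  induction L with
  | nil => simp [← one_eq_mk]
  | cons p L ih =>
    obtain ⟨x, b⟩ := p
    obtain rfl : x = y := h _ List.mem_cons_self
    rw [mk_cons, ih fun q hq => h q (List.mem_cons_of_mem _ hq), weight_cons, zpow_add]
    congr 1
    cases b
    · simp [of, inv_mk, invRev]
    · simp [of]

/-- A word involving two generators has weight zero for some weight that is nonzero on one of its
generators `t`; a second generator `y` is kept for measuring levels. -/
lemma exists_balanced_pair {L : List (α × Bool)} {a z : α} (haz : a ≠ z)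
    (ha : ∃ b, (a, b) ∈ L) (hz : ∃ b, (z, b) ∈ L) :
    ∃ (t y : α) (w : α → ℤ), y ≠ t ∧ w t ≠ 0 ∧ weight w L = 0 ∧ (∃ b, (t, b) ∈ L) ∧
      ∃ b, (y, b) ∈ L := by
  classical
  by_cases hexp : weight (Pi.single z 1) L = 0
  · exact ⟨z, a, Pi.single z 1, haz, by simp, hexp, hz, ha⟩
  · obtain ⟨w, hwa, hwL⟩ := exists_weight_eq_zero a z haz.symm L
    exact ⟨a, z, w, haz.symm, by rw [hwa]; simpa using hexp, hwL, ha, hz⟩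

lemma mem_of_normalClosure_eq {L₁ L₂ : List (α × Bool)}
    (hL₁ : IsCyclicallyReduced L₁) (hL₂ : IsCyclicallyReduced L₂) (hne : L₂ ≠ [])
    (h : Subgroup.normalClosure {mk L₁} = Subgroup.normalClosure {mk L₂})
    {x : α} (hx : ∃ b, (x, b) ∈ L₁) : ∃ b, (x, b) ∈ L₂ := by
  by_contra! hcon
  refine hne (isFreiheit_of_isCyclicallyReduced hL₁ x hx L₂ hL₂.isReduced ?_ ?_)
  · rintro ⟨_, b⟩ hp rfl
    exact hcon b hp
  · rw [h]
    exact Subgroup.subset_normalClosure rfl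

lemma eq_nil_of_normalClosure_eq {L₂ : List (α × Bool)} (hL₂ : IsCyclicallyReduced L₂)
    (h : Subgroup.normalClosure {mk ([] : List (α × Bool))} = Subgroup.normalClosure {mk L₂}) :
    L₂ = [] := by
  have h1 : mk L₂ ∈ Subgroup.normalClosure {mk ([] : List (α × Bool))} := by
    rw [h]
    exact Subgroup.subset_normalClosure rfl
  have hbot : Subgroup.normalClosure {mk ([] : List (α × Bool))} ≤ ⊥ := by
    apply Subgroup.normalClosure_le_normal
    rintro _ rfl
    rfl
  replace h1 : mk L₂ = 1 := hbot h1
  exact eq_of_mk_eq hL₂.isReduced IsReduced.nil h1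

/-- Magnus's conjugacy theorem for cyclically reduced words. -/
theorem isConj_or_isConj_inv_of_normalClosure_eq {L₁ L₂ : List (α × Bool)}
    (hL₁ : IsCyclicallyReduced L₁) (hL₂ : IsCyclicallyReduced L₂)
    (h : Subgroup.normalClosure {mk L₁} = Subgroup.normalClosure {mk L₂}) :
    IsConj (mk L₁) (mk L₂) ∨ IsConj (mk L₁) (mk L₂)⁻¹ := by
  classical
  induction hn : L₁.length using Nat.strong_induction_on generalizing α with
  | _ n IH =>
    subst hn
    have hmem₂ : mk L₂ ∈ Subgroup.normalClosure {mk L₁} := by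
      rw [h]; exact Subgroup.subset_normalClosure rfl
    have hmem₁ : mk L₁ ∈ Subgroup.normalClosure {mk L₂} := by
      rw [← h]; exact Subgroup.subset_normalClosure rfl
    by_cases hne₁ : L₁ = []
    · subst hne₁
      rw [eq_nil_of_normalClosure_eq hL₂ h]
      exact Or.inl (IsConj.refl _)
    by_cases hne₂ : L₂ = []
    · subst hne₂
      exact absurd (eq_nil_of_normalClosure_eq hL₁ h.symm) hne₁
    obtain ⟨⟨z, bz⟩, hz⟩ := List.exists_mem_of_ne_nil _ hne₁
    by_cases hall : ∀ p ∈ L₁, p.1 = z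
    -- Only one generator occurs: both words are powers of it, and each exponent divides the other.
    · have hall₂ : ∀ p ∈ L₂, p.1 = z := by
        rintro ⟨x, b⟩ hp
        obtain ⟨b', hb'⟩ := mem_of_normalClosure_eq hL₂ hL₁ hne₁ h.symm ⟨b, hp⟩
        exact hall (x, b') hb'
      rw [mk_eq_zpow_of_forall_eq hall, mk_eq_zpow_of_forall_eq hall₂]
      have hd := Int.natAbs_eq_of_dvd_dvd
        (dvd_weight_of_mem_normalClosure (w := Pi.single z 1) hmem₂)
        (dvd_weight_of_mem_normalClosure (w := Pi.single z 1) hmem₁)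
      rcases Int.natAbs_eq_natAbs_iff.1 hd with hd | hd
      · rw [hd]
        exact Or.inl (IsConj.refl _)
      · rw [hd, zpow_neg]
        exact Or.inr (IsConj.refl _)
    push Not at hall
    obtain ⟨⟨a, ba⟩, ha, haz⟩ := hall
    obtain ⟨t, y, w, hyt, ht, hw₁, htL₁, hyL₁⟩ := exists_balanced_pair haz ⟨_, ha⟩ ⟨_, hz⟩
    have hw₂ : weight w L₂ = 0 := by
      have := dvd_weight_of_mem_normalClosure (w := w) hmem₂
      rwa [hw₁, zero_dvd_iff] at this
    have htL₂ := mem_of_normalClosure_eq hL₁ hL₂ hne₂ h htL₁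
    have hyL₂ := mem_of_normalClosure_eq hL₁ hL₂ hne₂ h hyL₁
    obtain ⟨c₁, M₁, R₁, hM₁, hR₁, hy0₁, hyM₁, hRc₁, hlen⟩ :=
      exists_windowed_rewrite ht hyt hL₁ hw₁ htL₁ hyL₁
    obtain ⟨c₂, M₂, R₂, hM₂, hR₂, hy0₂, hyM₂, hRc₂, -⟩ :=
      exists_windowed_rewrite ht hyt hL₂ hw₂ htL₂ hyL₂
    have hF₁ := isFreiheit_of_isCyclicallyReduced hRc₁
    have hF₂ := isFreiheit_of_isCyclicallyReduced hRc₂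
    obtain rfl : M₁ = M₂ := le_antisymm
      (window_le ht hw₁ hL₂ hne₂ hmem₂ hM₁ hF₁ hR₁ hy0₁ hyM₁ hR₂)
      (window_le ht hw₂ hL₁ hne₁ hmem₁ hM₂ hF₂ hR₂ hy0₂ hyM₂ hR₁)
    have hR : Subgroup.normalClosure {mk R₁} = Subgroup.normalClosure {mk R₂} := by
      apply le_antisymm
      · apply Subgroup.normalClosure_le_normal
        rintro _ rfl
        exact mem_normalClosure_of_rewrite hM₂ hw₂ hF₂ hR₂ hy0₂ hyM₂ hmem₁ hR₁
      · apply Subgroup.normalClosure_le_normal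
        rintro _ rfl
        exact mem_normalClosure_of_rewrite hM₁ hw₁ hF₁ hR₁ hy0₁ hyM₁ hmem₂ hR₂
    have hr₁ : rewrite t w c₁ L₁ ≠ [] := fun h0 =>
      hne₁ (eq_nil_of_rewrite_eq_nil ht hL₁.isReduced hw₁ h0)
    have hconj := IH _ hlen hRc₁ hRc₂ hR rfl
    refine hconj.imp (fun hc => ?_) (fun hc => ?_)
    · have hrot := isRotated_of_isConj hRc₁ hRc₂ hc.symm
      have hrot' := hrot.map fun p => (p.1.1, p.2)
      rw [hR₁, hR₂] at hrot'
      exact isConj_of_isRotated_rewrite ht hw₁ hw₂ hr₁ hrot'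
    · rw [inv_mk] at hc ⊢
      have hrot := isRotated_of_isConj hRc₁ (isCyclicallyReduced_invRev hRc₂) hc.symm
      have hrot' := hrot.map fun p => (p.1.1, p.2)
      have hinv : (invRev R₂).map (fun p => (p.1.1, p.2)) = rewrite t w c₂ (invRev L₂) := by
        rw [rewrite_invRev, hw₂, sub_zero, ← hR₂]
        simp [invRev, Function.comp_def]
      rw [hR₁, hinv] at hrot'
      refine isConj_of_isRotated_rewrite ht hw₁ ?_ hr₁ hrot'
      rw [weight_invRev, hw₂, neg_zero]

lemma normalClosure_singleton_eq_of_isConj {G : Type*} [Group G] {g g' : G} (h : IsConj g g') :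
    Subgroup.normalClosure {g} = Subgroup.normalClosure {g'} := by
  have hle : ∀ {g g' : G}, IsConj g g' →
      Subgroup.normalClosure {g} ≤ Subgroup.normalClosure {g'} := by
    intro g g' hg
    obtain ⟨k, rfl⟩ := isConj_iff.1 hg.symm
    apply Subgroup.normalClosure_le_normal
    rw [Set.singleton_subset_iff]
    exact (Subgroup.normalClosure_normal (s := {g'})).conj_mem g'
      (Subgroup.subset_normalClosure (Set.mem_singleton g')) k
  exact le_antisymm (hle h) (hle h.symm)

/-- **Magnus's conjugacy theorem**: two elements of a free group with the same normal closure are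
conjugate up to inversion. -/
theorem isConj_or_isConj_inv_of_normalClosure_singleton_eq {r s : FreeGroup α}
    (h : Subgroup.normalClosure {r} = Subgroup.normalClosure {s}) :
    IsConj r s ∨ IsConj r s⁻¹ := by
  classical
  have key : ∀ g : FreeGroup α, ∃ L, IsCyclicallyReduced L ∧ IsConj g (mk L) := by
    intro g
    refine ⟨_, reduceCyclically.isCyclicallyReduced (isReduced_toWord (x := g)), ?_⟩
    have h := congrArg mk (reduceCyclically.conj_conjugator_reduceCyclically g.toWord)
    rw [← mul_mk, ← mul_mk, ← inv_mk, mk_toWord] at h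
    exact (isConj_iff.2 ⟨_, h⟩).symm
  obtain ⟨L₁, hL₁, hr⟩ := key r
  obtain ⟨L₂, hL₂, hs⟩ := key s
  rw [normalClosure_singleton_eq_of_isConj hr, normalClosure_singleton_eq_of_isConj hs] at h
  have hs' : IsConj s⁻¹ (mk L₂)⁻¹ := by
    obtain ⟨k, hk⟩ := isConj_iff.1 hs
    exact isConj_iff.2 ⟨k, by rw [← hk]; group⟩
  exact (isConj_or_isConj_inv_of_normalClosure_eq hL₁ hL₂ h).imp
    (fun hc => hr.trans (hc.trans hs.symm)) (fun hc => hr.trans (hc.trans hs'.symm))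

end OneRelator

/-! ### Group algebras -/

namespace OneRelator

lemma wordQuotientMap_eq_iff {G : Type*} [Group G] {v : G} {a b : MonoidAlgebra ℂ G} :
    wordQuotientMap v a = wordQuotientMap v b ↔ a - b ∈ wordIdeal v := by
  rw [← TwoSidedIdeal.rel_iff]
  exact RingCon.eq _

theorem wordQuotientMap_of_eq_one_iff {G : Type*} [Group G] {v g : G} :
    wordQuotientMap v (MonoidAlgebra.of ℂ G g) = 1 ↔ g ∈ Subgroup.normalClosure {v} := by
  constructor
  · intro hg
    let N := Subgroup.normalClosure {v}
    let f : MonoidAlgebra ℂ G →ₐ[ℂ] MonoidAlgebra ℂ (G ⧸ N) :=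
      MonoidAlgebra.mapDomainAlgHom ℂ ℂ (QuotientGroup.mk' N)
    have hf : ∀ x : G, f (MonoidAlgebra.of ℂ G x) = MonoidAlgebra.of ℂ (G ⧸ N) x := by
      intro x
      simp [f]
    have hle : wordIdeal v ≤ TwoSidedIdeal.ker f := by
      rw [wordIdeal, TwoSidedIdeal.span_le, Set.singleton_subset_iff, SetLike.mem_coe,
        TwoSidedIdeal.mem_ker, map_sub, map_one, hf, sub_eq_zero]
      have hv : (v : G ⧸ N) = 1 :=
        (QuotientGroup.eq_one_iff v).2 (Subgroup.subset_normalClosure rfl)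
      rw [hv, map_one]
    rw [← map_one (wordQuotientMap v), wordQuotientMap_eq_iff] at hg
    have h := hle hg
    rw [TwoSidedIdeal.mem_ker, map_sub, map_one, hf, sub_eq_zero] at h
    exact (QuotientGroup.eq_one_iff g).1 (MonoidAlgebra.of_injective (h.trans (map_one _).symm))
  · intro hg
    let f : G →* WordQuotient v :=
      (wordQuotientMap v : MonoidAlgebra ℂ G →* WordQuotient v).comp (MonoidAlgebra.of ℂ G)
    have hle : Subgroup.normalClosure {v} ≤ f.ker := by
      apply Subgroup.normalClosure_le_normal
      rw [Set.singleton_subset_iff, SetLike.mem_coe, MonoidHom.mem_ker]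
      change wordQuotientMap v (MonoidAlgebra.of ℂ G v) = 1
      rw [← map_one (wordQuotientMap v), wordQuotientMap_eq_iff]
      exact TwoSidedIdeal.subset_span rfl
    exact hle hg

end OneRelator

theorem lemma5p1 (m : ℕ)
    (lam' lam : FreeGroup (Fin m))
    (ε : FreeGroup (Fin m) ≃* FreeGroup (Fin m))
    (τ : MonoidAlgebra ℂ (FreeGroup (Fin m)) ≃ₐ[ℂ] MonoidAlgebra ℂ (FreeGroup (Fin m)))
    (hτ : ∀ g : FreeGroup (Fin m), τ (MonoidAlgebra.of ℂ _ g) = MonoidAlgebra.of ℂ _ (ε g))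
    (τt : WordQuotient lam' ≃ₐ[ℂ] WordQuotient lam)
    (hcomm : ∀ a : MonoidAlgebra ℂ (FreeGroup (Fin m)),
      τt (wordQuotientMap lam' a) = wordQuotientMap lam (τ a)) :
    ∃ (u : FreeGroup (Fin m)) (c : ℤ), (c = 1 ∨ c = -1) ∧
      τ (MonoidAlgebra.of ℂ _ lam') =
        MonoidAlgebra.of ℂ _ u * MonoidAlgebra.of ℂ _ (lam ^ c) * MonoidAlgebra.of ℂ _ u⁻¹ := by
  have hmem : ∀ g, g ∈ Subgroup.normalClosure {lam'} ↔ ε g ∈ Subgroup.normalClosure {lam} := by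
    intro g
    rw [← OneRelator.wordQuotientMap_of_eq_one_iff, ← OneRelator.wordQuotientMap_of_eq_one_iff,
      ← hτ, ← hcomm, map_eq_one_iff τt τt.injective]
  have hnc : Subgroup.normalClosure {ε lam'} = Subgroup.normalClosure {lam} := by
    apply le_antisymm
    · apply Subgroup.normalClosure_le_normal
      rw [Set.singleton_subset_iff]
      exact (hmem lam').1 (Subgroup.subset_normalClosure rfl)
    · apply Subgroup.normalClosure_le_normal
      rw [Set.singleton_subset_iff]
      have hlam : ε.symm lam ∈ Subgroup.normalClosure {lam'} := by
        rw [hmem, ε.apply_symm_apply]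
        exact Subgroup.subset_normalClosure rfl
      have hle : Subgroup.normalClosure {lam'} ≤
          (Subgroup.normalClosure {ε lam'}).comap ε.toMonoidHom := by
        apply Subgroup.normalClosure_le_normal
        rw [Set.singleton_subset_iff]
        exact Subgroup.subset_normalClosure rfl
      have h := hle hlam
      rw [Subgroup.mem_comap] at h
      simpa using h
  have key : ∀ c : ℤ, IsConj (ε lam') (lam ^ c) → ∃ u : FreeGroup (Fin m),
      τ (MonoidAlgebra.of ℂ _ lam') =
        MonoidAlgebra.of ℂ _ u * MonoidAlgebra.of ℂ _ (lam ^ c) * MonoidAlgebra.of ℂ _ u⁻¹ := by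
    intro c hc
    obtain ⟨u, hu⟩ := isConj_iff.1 hc.symm
    exact ⟨u, by rw [hτ, ← hu, map_mul, map_mul]⟩
  rcases OneRelator.isConj_or_isConj_inv_of_normalClosure_singleton_eq hnc with h | h
  · obtain ⟨u, hu⟩ := key 1 (by rwa [zpow_one])
    exact ⟨u, 1, Or.inl rfl, hu⟩
  · obtain ⟨u, hu⟩ := key (-1) (by rwa [zpow_neg_one])
    exact ⟨u, -1, Or.inr rfl, hu⟩
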